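/- An overpartition of a nonnegative integer $n$ is a nonincreasing sequence of positive integers with sum $n$ in which the first occurrence of each distinct part may be overlined. For an odd integer $t\ge 3$, a $t$-Schur overpartition of $n$ is an overpartition of $n$ all of whose parts are congruent modulo $2t$ to elements of $I(t)=\{1,3,5,\dots,2t-1\}\setminus\{t\}$, and $\overline{S}_t(n)$ denotes the number of $t$-Schur overpartitions of $n$ (so $\overline{S}_t(0)=1$). Theorem. For all integers $n\ge 0$, $\alpha\ge 0$ and $\beta\ge 1$, \begin{align*} \overline{S}_3(3n) &\equiv \overline{S}_3(n) \pmod 4,\\ \overline{S}_3\big(2^{\alpha}(3n+j)\big) &\equiv \overline{S}_3(3n+j) \pmod 4 && \text{for each } j\in\{0,1,2\},\\ \overline{S}_3\big(2^{2\beta+j}(3n+2)\big) &\equiv \overline{S}_3\big(2^{j}(3n+2)\big) \pmod 8 && \text{for each } j\in\{0,1\}. \end{align*} -/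

import Mathlib

/-- The set `I(t) = {1, 3, 5, …, 2t - 1} \ {t}` of admissible residues modulo `2t`. -/
def schurResidues (t : ℕ) : Finset ℕ :=
  ((Finset.range (2 * t)).filter Odd).erase t

/-- The `t`-Schur overpartitions of `n`. An overpartition of `n` is a partition of `n` in which
the first occurrence of each distinct part may be overlined, that is, a pair consisting of a
partition `p` of `n` and a set of distinct parts of `p` (the sizes whose first occurrence is
overlined). It is a `t`-Schur overpartition if each part is congruent modulo `2t` to an element
of `I(t)`. -/
def schurOverpartitions (t n : ℕ) : Finset (Σ _ : n.Partition, Finset ℕ) :=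
  (Nat.Partition.restricted n (fun i => i % (2 * t) ∈ schurResidues t)).sigma
    fun p => p.parts.toFinset.powerset

/-- The number of `t`-Schur overpartitions of `n`. -/
def schurOverpartitionCount (t n : ℕ) : ℕ :=
  (schurOverpartitions t n).card

/-! Write `T_d = ∑_{a ≥ 1} (-1)^a X^(d a²)` for `thetaTail d`. Gauss's identity turns the generating
function into the quotient `(1 + 2T_2)(1 + 2T_3) / ((1 + 2T_1)(1 + 2T_6))` (`genFun_mul_theta`).
Since `T_d² ≡ T_{2d}` mod 2, inverting the denominator mod 8 leaves a constant, twice a linear form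
in the `T_d`, and four times a sum of `T_d` and `T_i T_j` (`exists_genFun_eq`). Mod 4 only the
parity of the linear form counts. It records whether `n` is 1, 2, 3 or 6 times a square, and
multiplication by 2 or 3 permutes these classes. Mod 8, compare `4n` with `n`. The products `T_i
T_j` count representations by `i a² + j b²`; only the forms (1,3) and (2,6) acquire new solutions.
These are paired off by a sixth root of unity in `ℤ[√-3]` (`card_oddPairs`), and any surviving fixed
point cancels a sign change in `T_2`. -/

/-! ### Finite form of Gauss's identity. -/

section FiniteGauss

variable {R : Type*} [CommRing R]

/-- The remainder in the finite form of Gauss's identity for `∑ (-1)^k x^(k^2)`. -/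
def gaussRemainder (x : R) (n : ℕ) : R :=
  ∑ s ∈ Finset.range n, (-1) ^ (s + 1) * (∏ k ∈ Finset.range s, (1 + x ^ (k + 1))) *
    (∏ k ∈ Finset.Ico (s + 1) n, (1 - x ^ (k + 1))) * x ^ ((s + 1) * (n + 1))

/-- The last factor is what each summand of the remainder gains from `n` to `n + 1`, minus the
multiplier `1 + x^(n+1)` of the recurrence. -/
theorem gaussRemainder_telescope (x : R) (n m : ℕ) (hm : m ≤ n) :
    ∑ s ∈ Finset.range m, (-1) ^ (s + 1) * (∏ k ∈ Finset.range s, (1 + x ^ (k + 1))) *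
      (∏ k ∈ Finset.Ico (s + 1) n, (1 - x ^ (k + 1))) * x ^ ((s + 1) * (n + 1)) *
        (x ^ (s + 1) * (1 - x ^ (n + 1)) - (1 + x ^ (n + 1))) =
    (∏ k ∈ Finset.range n, (1 - x ^ (k + 1))) * x ^ (n + 1) -
      (-1) ^ m * (∏ k ∈ Finset.range m, (1 + x ^ (k + 1))) *
        (∏ k ∈ Finset.Ico m n, (1 - x ^ (k + 1))) * x ^ ((m + 1) * (n + 1)) := by
  induction m with
  | zero => simp
  | succ m ih =>
    rw [Finset.sum_range_succ, ih (by omega), Finset.prod_range_succ _ m,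
      Finset.prod_eq_prod_Ico_succ_bot (by omega : m < n)]
    ring

theorem gaussRemainder_succ (x : R) (n : ℕ) :
    gaussRemainder x (n + 1) = (1 + x ^ (n + 1)) * gaussRemainder x n +
      (∏ k ∈ Finset.range n, (1 - x ^ (k + 1))) * x ^ (n + 1) -
      (-1) ^ n * (∏ k ∈ Finset.range n, (1 + x ^ (k + 1))) * x ^ ((n + 1) * (n + 1)) *
        (1 + x ^ (n + 1)) := by
  have h := gaussRemainder_telescope x n n le_rfl
  rw [Finset.Ico_self, Finset.prod_empty] at h
  have h2 : ∑ s ∈ Finset.range n, (-1) ^ (s + 1) * (∏ k ∈ Finset.range s, (1 + x ^ (k + 1))) *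
      (∏ k ∈ Finset.Ico (s + 1) (n + 1), (1 - x ^ (k + 1))) * x ^ ((s + 1) * (n + 1 + 1)) =
      (1 + x ^ (n + 1)) * gaussRemainder x n + ∑ s ∈ Finset.range n,
      (-1) ^ (s + 1) * (∏ k ∈ Finset.range s, (1 + x ^ (k + 1))) *
      (∏ k ∈ Finset.Ico (s + 1) n, (1 - x ^ (k + 1))) * x ^ ((s + 1) * (n + 1)) *
        (x ^ (s + 1) * (1 - x ^ (n + 1)) - (1 + x ^ (n + 1))) := by
    rw [gaussRemainder, Finset.mul_sum, ← Finset.sum_add_distrib]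
    refine Finset.sum_congr rfl fun s hs => ?_
    rw [Finset.prod_Ico_succ_top (by simp at hs; omega)]
    ring
  rw [gaussRemainder, Finset.sum_range_succ, h2, h, Finset.Ico_self, Finset.prod_empty]
  ring

/-- A finite form of Gauss's identity `∑ (-1)^k x^(k^2) = ∏ (1 - x^k) / (1 + x^k)`. -/
theorem finite_gauss (x : R) (n : ℕ) :
    (∏ k ∈ Finset.range n, (1 + x ^ (k + 1))) *
      (1 + 2 * ∑ k ∈ Finset.range n, (-1) ^ (k + 1) * x ^ ((k + 1) ^ 2)) =
    (∏ k ∈ Finset.range n, (1 - x ^ (k + 1))) + 2 * gaussRemainder x n := by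
  induction n with
  | zero => simp [gaussRemainder]
  | succ n ih =>
    rw [gaussRemainder_succ, Finset.prod_range_succ, Finset.prod_range_succ,
      Finset.sum_range_succ]
    linear_combination (1 + x ^ (n + 1)) * ih

end FiniteGauss

/-! ### Infinite products and the theta quotient. -/

section Products

open PowerSeries Filter
open scoped PowerSeries.WithPiTopology Topology

/-- The power series `∑_{a ≥ 1} (-1)^a X^(d a^2)`. -/
noncomputable def thetaTail (d : ℕ) : PowerSeries ℤ :=
  PowerSeries.mk fun n => ∑ a ∈ Finset.Icc 1 n, if d * a ^ 2 = n then (-1) ^ a else 0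

theorem coeff_sum_theta {d n m : ℕ} (hd : 0 < d) (h : n ≤ m) :
    coeff n (∑ k ∈ Finset.range m, (-1) ^ (k + 1) * ((X : PowerSeries ℤ) ^ d) ^ ((k + 1) ^ 2)) =
      coeff n (thetaTail d) := by
  have h1 : ∀ k, coeff n ((-1) ^ (k + 1) * ((X : PowerSeries ℤ) ^ d) ^ ((k + 1) ^ 2)) =
      if d * (k + 1) ^ 2 = n then (-1) ^ (k + 1) else 0 := by
    intro k
    have : ((-1) ^ (k + 1) : PowerSeries ℤ) = C ((-1) ^ (k + 1)) := by simp
    rw [this, coeff_C_mul, ← pow_mul, coeff_X_pow]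
    simp [eq_comm]
  rw [map_sum, thetaTail, coeff_mk]
  simp only [h1]
  symm
  rw [← Finset.sum_range_add_sum_Ico _ h, Finset.sum_eq_zero (s := Finset.Ico n m), add_zero,
    Finset.range_eq_Ico, Finset.sum_Ico_add' (fun a => if d * a ^ 2 = n then (-1 : ℤ) ^ a else 0)]
  · rfl
  · intro k hk
    rw [Finset.mem_Ico] at hk
    rw [if_neg]
    nlinarith [Nat.mul_le_mul hd (le_refl ((k + 1) ^ 2))]

theorem tendsto_sum_theta {d : ℕ} (hd : 0 < d) :
    Tendsto (fun n => ∑ k ∈ Finset.range n,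
      (-1) ^ (k + 1) * ((X : PowerSeries ℤ) ^ d) ^ ((k + 1) ^ 2)) atTop (𝓝 (thetaTail d)) := by
  rw [WithPiTopology.tendsto_iff_coeff_tendsto]
  exact fun n => tendsto_atTop_of_eventually_const (i₀ := n) fun m hm => coeff_sum_theta hd hm

/-- The `n`-th remainder is divisible by `X^(d(n+1))`. -/
theorem tendsto_gaussRemainder {d : ℕ} (hd : 0 < d) :
    Tendsto (fun n => gaussRemainder ((X : PowerSeries ℤ) ^ d) n) atTop (𝓝 0) := by
  rw [WithPiTopology.tendsto_iff_coeff_tendsto]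
  refine fun n => tendsto_atTop_of_eventually_const (i₀ := n) fun m hm => ?_
  rw [gaussRemainder, map_sum, map_zero]
  refine Finset.sum_eq_zero fun s _ => ?_
  rw [← pow_mul, coeff_mul_X_pow', if_neg]
  have : m + 1 ≤ d * ((s + 1) * (m + 1)) := by
    rw [← mul_assoc]
    exact Nat.le_mul_of_pos_left _ (by positivity)
  omega

/-- The factor `1 + ε X^(i+1)` if `i + 1` satisfies `p`, and `1` otherwise. -/
noncomputable def sieveFactor (ε : ℤ) (p : ℕ → Prop) [DecidablePred p] (i : ℕ) : PowerSeries ℤ :=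
  if p (i + 1) then 1 + C ε * X ^ (i + 1) else 1

theorem multipliable_sieveFactor (ε : ℤ) (p : ℕ → Prop) [DecidablePred p] :
    Multipliable (sieveFactor ε p) := by
  have : sieveFactor ε p = fun i => 1 + if p (i + 1) then C ε * X ^ (i + 1) else 0 := by
    ext1 i
    unfold sieveFactor
    split_ifs <;> simp
  rw [this]
  apply WithPiTopology.multipliable_one_add_of_tendsto_order_atTop_nhds_top
  refine ENat.tendsto_nhds_top_iff_natCast_lt.mpr fun n => eventually_atTop.mpr ⟨n, fun m hm => ?_⟩
  refine lt_of_lt_of_le (b := ((m + 1 : ℕ) : ℕ∞)) (by norm_cast; omega) ?_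
  refine nat_le_order _ _ fun i hi => ?_
  split_ifs
  · rw [coeff_C_mul, coeff_X_pow, if_neg (by omega), mul_zero]
  · simp

theorem tprod_sieveFactor_ne_zero (ε : ℤ) (p : ℕ → Prop) [DecidablePred p] :
    ∏' i, sieveFactor ε p i ≠ 0 := by
  have h : constantCoeff (∏' i, sieveFactor ε p i) = 1 := by
    rw [(multipliable_sieveFactor ε p).map_tprod _ (WithPiTopology.continuous_constantCoeff ℤ)]
    refine (tprod_congr fun i => ?_).trans tprod_one
    unfold sieveFactor
    split_ifs <;> simp
  intro h0
  simp [h0] at h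

/-- Indexing every product by all `i` allows factorwise comparison; the injection `k ↦ d(k+1) - 1`
recovers the product over multiples of `d`. -/
theorem tendsto_prod_sieveFactor_dvd (ε : ℤ) {d : ℕ} (hd : 0 < d) :
    Tendsto (fun n => ∏ k ∈ Finset.range n, (1 + C ε * ((X : PowerSeries ℤ) ^ d) ^ (k + 1))) atTop
      (𝓝 (∏' i, sieveFactor ε (d ∣ ·) i)) := by
  have hinj : Function.Injective fun k : ℕ => d * (k + 1) - 1 := by
    intro a b h
    have ha : 0 < d * (a + 1) := by positivity
    have hb : 0 < d * (b + 1) := by positivity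
    have : d * (a + 1) = d * (b + 1) := by simp only at h; omega
    have := Nat.eq_of_mul_eq_mul_left hd this
    omega
  have h := (hinj.hasProd_iff (f := sieveFactor ε (d ∣ ·)) (fun i hi => ?_)).mpr
    (multipliable_sieveFactor ε (d ∣ ·)).hasProd
  · convert h.tendsto_prod_nat using 4 with n k
    have : d * (k + 1) - 1 + 1 = d * (k + 1) := Nat.sub_add_cancel (Nat.mul_pos hd k.succ_pos)
    simp [sieveFactor, this, pow_mul]
  · unfold sieveFactor
    refine if_neg fun ⟨c, hc⟩ => hi ⟨c - 1, ?_⟩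
    have : c ≠ 0 := by rintro rfl; simp at hc
    simp only
    rw [Nat.sub_add_cancel (by omega), ← hc]
    simp

/-- Gauss's identity `∑_{k ∈ ℤ} (-1)^k X^(d k^2) = ∏ (1 - X^(d k)) / (1 + X^(d k))`. -/
theorem gauss_identity {d : ℕ} (hd : 0 < d) :
    (∏' i, sieveFactor 1 (d ∣ ·) i) * (1 + 2 * thetaTail d) = ∏' i, sieveFactor (-1) (d ∣ ·) i := by
  have h1 := (tendsto_prod_sieveFactor_dvd 1 hd).mul
    (((tendsto_sum_theta hd).const_mul 2).const_add 1)
  have h2 := (tendsto_prod_sieveFactor_dvd (-1) hd).add ((tendsto_gaussRemainder hd).const_mul 2)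
  rw [mul_zero, add_zero] at h2
  refine tendsto_nhds_unique h1 (h2.congr fun n => ?_)
  have := finite_gauss ((X : PowerSeries ℤ) ^ d) n
  simpa [sub_eq_add_neg] using this.symm

/-- Each admissible part size is overlined or not, giving weight 2; weight 0 kills inadmissible
partitions. -/
theorem schurOverpartitionCount_eq_sum (n : ℕ) :
    (schurOverpartitionCount 3 n : ℤ) = ∑ p : n.Partition, p.parts.toFinsupp.prod
      fun i _ => if i % 6 ∈ schurResidues 3 then (2 : ℤ) else 0 := by
  rw [schurOverpartitionCount, schurOverpartitions, Finset.card_sigma, Nat.Partition.restricted,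
    Finset.sum_filter]
  push_cast
  refine Finset.sum_congr rfl fun p _ => ?_
  rw [Finsupp.prod, Finset.prod_ite_zero]
  simp [Finset.card_powerset]

theorem hasProd_schurOverpartitionCount :
    HasProd (fun i => 1 + ∑' j, C (if (i + 1) % 6 ∈ schurResidues 3 then (2 : ℤ) else 0) *
      (X : PowerSeries ℤ) ^ ((i + 1) * (j + 1)))
      (PowerSeries.mk fun n => (schurOverpartitionCount 3 n : ℤ)) := by
  have h : (PowerSeries.mk fun n => (schurOverpartitionCount 3 n : ℤ)) =
      Nat.Partition.genFun fun i _ => if i % 6 ∈ schurResidues 3 then (2 : ℤ) else 0 := by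
    ext n
    rw [Nat.Partition.coeff_genFun, coeff_mk, schurOverpartitionCount_eq_sum]
  rw [h]
  have h2 := Nat.Partition.hasProd_genFun
    fun i _ => if i % 6 ∈ schurResidues 3 then (2 : ℤ) else 0
  simp only [smul_eq_C_mul] at h2
  exact h2

theorem one_add_tsum_mul_one_sub (c : ℤ) (i : ℕ) :
    (1 + ∑' j, C c * (X : PowerSeries ℤ) ^ ((i + 1) * (j + 1))) * (1 - X ^ (i + 1)) =
      1 + C (c - 1) * X ^ (i + 1) := by
  have h : ∑' j, C c * (X : PowerSeries ℤ) ^ ((i + 1) * (j + 1)) =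
      C c * X ^ (i + 1) * ∑' j, ((X : PowerSeries ℤ) ^ (i + 1)) ^ j := by
    have hs : Summable fun j => ((X : PowerSeries ℤ) ^ (i + 1)) ^ j :=
      WithPiTopology.summable_pow_of_constantCoeff_eq_zero (by simp)
    rw [← hs.tsum_mul_left]
    refine tsum_congr fun j => ?_
    rw [pow_mul, pow_succ]
    ring
  rw [h, add_mul, mul_assoc,
    WithPiTopology.tsum_pow_mul_one_sub_of_constantCoeff_eq_zero (by simp), map_sub, map_one]
  ring

/-- The generating function of `schurOverpartitionCount 3` as a quotient of theta series. -/
theorem genFun_mul_theta :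
    (PowerSeries.mk fun n => (schurOverpartitionCount 3 n : ℤ)) *
        ((1 + 2 * thetaTail 1) * (1 + 2 * thetaTail 6)) =
      (1 + 2 * thetaTail 2) * (1 + 2 * thetaTail 3) := by
  have hG := hasProd_schurOverpartitionCount
  have P := fun (ε : ℤ) (d : ℕ) => (multipliable_sieveFactor ε (d ∣ ·)).hasProd
  -- Cleared of denominators, the identity holds factor by factor, according to whether 2 and 3
  -- divide `i + 1`.
  have h1 := hG.mul ((P (-1) 1).mul ((P (-1) 6).mul ((P 1 2).mul (P 1 3))))
  have h2 := (P 1 1).mul ((P 1 6).mul ((P (-1) 2).mul (P (-1) 3)))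
  have h3 := h1.unique (h2.congr_fun fun i => ?_)
  · rw [← gauss_identity (d := 1) (by norm_num), ← gauss_identity (d := 6) (by norm_num),
      ← gauss_identity (d := 2) (by norm_num), ← gauss_identity (d := 3) (by norm_num)] at h3
    have hne : (∏' i, sieveFactor 1 (1 ∣ ·) i) * (∏' i, sieveFactor 1 (6 ∣ ·) i) *
        (∏' i, sieveFactor 1 (2 ∣ ·) i) * (∏' i, sieveFactor 1 (3 ∣ ·) i) ≠ 0 := by
      simp only [ne_eq, mul_eq_zero, tprod_sieveFactor_ne_zero, or_self, not_false_eq_true]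
    apply mul_left_cancel₀ hne
    linear_combination h3
  · have hc : (i + 1) % 6 ∈ schurResidues 3 ↔ ¬ 2 ∣ i + 1 ∧ ¬ 3 ∣ i + 1 := by
      have h6 : (i + 1) % 6 < 6 := Nat.mod_lt _ (by norm_num)
      have h : ∀ x < 6, (x ∈ schurResidues 3 ↔ x % 2 ≠ 0 ∧ x % 3 ≠ 0) := by decide
      rw [h _ h6]
      omega
    have h6 : 6 ∣ i + 1 ↔ 2 ∣ i + 1 ∧ 3 ∣ i + 1 := by omega
    simp only [sieveFactor, one_dvd, if_true, h6, hc]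
    by_cases h2 : 2 ∣ i + 1 <;> by_cases h3 : 3 ∣ i + 1 <;> simp [h2, h3]
    · ring
    · ring
    · ring
    · have := one_add_tsum_mul_one_sub 2 i
      norm_num [sub_eq_add_neg] at this ⊢
      exact this

end Products

/-! ### Expansion modulo 8 and representation counts. -/

section Coefficients

open PowerSeries

/-- The solutions of `i a^2 + j b^2 = n` in positive integers. -/
def squarePairs (i j n : ℕ) : Finset (ℕ × ℕ) :=
  (Finset.Icc 1 n ×ˢ Finset.Icc 1 n).filter fun p => i * p.1 ^ 2 + j * p.2 ^ 2 = n

theorem mem_squarePairs {i j n : ℕ} (hi : 0 < i) (hj : 0 < j) {p : ℕ × ℕ} :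
    p ∈ squarePairs i j n ↔ 1 ≤ p.1 ∧ 1 ≤ p.2 ∧ i * p.1 ^ 2 + j * p.2 ^ 2 = n := by
  simp only [squarePairs, Finset.mem_filter, Finset.mem_product, Finset.mem_Icc]
  refine ⟨fun h => ⟨h.1.1.1, h.1.2.1, h.2⟩, fun ⟨h1, h2, h⟩ => ⟨⟨⟨h1, ?_⟩, h2, ?_⟩, h⟩⟩
  · nlinarith [Nat.mul_le_mul hi (le_refl (p.1 ^ 2)), Nat.zero_le (j * p.2 ^ 2)]
  · nlinarith [Nat.mul_le_mul hj (le_refl (p.2 ^ 2)), Nat.zero_le (i * p.1 ^ 2)]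

theorem coeff_thetaTail_mul_sq {d a : ℕ} (hd : 0 < d) (ha : 1 ≤ a) :
    coeff (d * a ^ 2) (thetaTail d) = (-1) ^ a := by
  rw [thetaTail, coeff_mk, Finset.sum_eq_single a]
  · simp
  · intro b _ hb
    rw [if_neg]
    intro h
    exact hb (Nat.pow_left_injective two_ne_zero (Nat.eq_of_mul_eq_mul_left hd h))
  · intro h
    refine absurd (Finset.mem_Icc.mpr ⟨ha, ?_⟩) h
    nlinarith [Nat.mul_le_mul hd (le_refl (a ^ 2))]

theorem coeff_thetaTail_eq_zero {d n : ℕ} (h : ∀ a, 1 ≤ a → d * a ^ 2 ≠ n) :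
    coeff n (thetaTail d) = 0 := by
  rw [thetaTail, coeff_mk]
  exact Finset.sum_eq_zero fun a ha => if_neg (h a (Finset.mem_Icc.mp ha).1)

open Classical in
theorem cast_coeff_thetaTail {d n : ℕ} (hd : 0 < d) :
    ((coeff n (thetaTail d) : ℤ) : ZMod 2) = if ∃ a, 1 ≤ a ∧ d * a ^ 2 = n then 1 else 0 := by
  split_ifs with h
  · obtain ⟨a, ha, rfl⟩ := h
    rw [coeff_thetaTail_mul_sq hd ha]
    push_cast
    rw [show (-1 : ZMod 2) = 1 by decide, one_pow]
  · rw [coeff_thetaTail_eq_zero fun a ha h' => h ⟨a, ha, h'⟩, Int.cast_zero]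

theorem cast_coeff_thetaTail_eq_sum {d n m : ℕ} (hd : 0 < d) (hm : n ≤ m) :
    ((coeff n (thetaTail d) : ℤ) : ZMod 2) =
      ∑ a ∈ Finset.Icc 1 m, if d * a ^ 2 = n then 1 else 0 := by
  rw [thetaTail, coeff_mk]
  push_cast
  rw [show (-1 : ZMod 2) = 1 by decide]
  simp only [one_pow]
  refine Finset.sum_subset (Finset.Icc_subset_Icc_right hm) fun a ha ha' => if_neg fun h => ?_
  rw [Finset.mem_Icc] at ha ha'
  refine ha' ⟨ha.1, ?_⟩
  nlinarith [Nat.mul_le_mul hd (le_refl (a ^ 2))]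

theorem cast_coeff_thetaTail_mul {i j n : ℕ} (hi : 0 < i) (hj : 0 < j) :
    ((coeff n (thetaTail i * thetaTail j) : ℤ) : ZMod 2) = (squarePairs i j n).card := by
  rw [coeff_mul]
  push_cast
  calc _ = ∑ p ∈ Finset.HasAntidiagonal.antidiagonal n, ∑ q ∈ Finset.Icc 1 n ×ˢ Finset.Icc 1 n,
        (if p = (i * q.1 ^ 2, j * q.2 ^ 2) then (1 : ZMod 2) else 0) := by
        refine Finset.sum_congr rfl fun p hp => ?_
        rw [Finset.HasAntidiagonal.mem_antidiagonal] at hp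
        rw [cast_coeff_thetaTail_eq_sum hi (show p.1 ≤ n by omega),
          cast_coeff_thetaTail_eq_sum hj (show p.2 ≤ n by omega), Finset.sum_mul_sum,
          Finset.sum_product]
        refine Finset.sum_congr rfl fun a _ => Finset.sum_congr rfl fun b _ => ?_
        rw [ite_zero_mul_ite_zero, mul_one]
        simp only [Prod.ext_iff, eq_comm]
    _ = _ := by
        rw [Finset.sum_comm, squarePairs, Finset.card_filter]
        push_cast
        refine Finset.sum_congr rfl fun q _ => ?_
        rw [Finset.sum_ite_eq']
        simp

/-- Swapping coordinates pairs off the non-diagonal solutions. -/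
theorem card_squarePairs_self {d n : ℕ} (hd : 0 < d) :
    ((squarePairs d d n).card : ZMod 2) = ((coeff n (thetaTail (2 * d)) : ℤ) : ZMod 2) := by
  classical
  rw [← Finset.card_filter_add_card_filter_not (s := squarePairs d d n) (fun p => p.1 = p.2)]
  have h0 : (((squarePairs d d n).filter fun p => ¬ p.1 = p.2).card : ZMod 2) = 0 := by
    rw [Finset.card_eq_sum_ones]
    push_cast
    refine Finset.sum_involution (fun p _ => p.swap) (fun _ _ => by decide) ?_ ?_ ?_
    · intro p hp _ h
      rw [Finset.mem_filter] at hp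
      exact hp.2 (congrArg Prod.fst h).symm
    · intro p hp
      rw [Finset.mem_filter, mem_squarePairs hd hd] at hp ⊢
      exact ⟨⟨hp.1.2.1, hp.1.1, by rw [← hp.1.2.2]; simp [add_comm]⟩, fun h => hp.2 h.symm⟩
    · simp
  rw [Nat.cast_add, h0, add_zero, cast_coeff_thetaTail (by omega)]
  split_ifs with h
  · obtain ⟨a, ha, rfl⟩ := h
    have : (squarePairs d d (2 * d * a ^ 2)).filter (fun p => p.1 = p.2) = {(a, a)} := by
      ext ⟨x, y⟩
      rw [Finset.mem_filter, mem_squarePairs hd hd, Finset.mem_singleton, Prod.mk.injEq]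
      constructor
      · rintro ⟨⟨_, _, h⟩, h'⟩
        simp only at h h'
        subst h'
        have h2 : 2 * d * x ^ 2 = 2 * d * a ^ 2 := by rw [← h]; ring
        have := Nat.pow_left_injective two_ne_zero
          (Nat.eq_of_mul_eq_mul_left (by omega : 0 < 2 * d) h2)
        exact ⟨this, this⟩
      · rintro ⟨rfl, rfl⟩
        exact ⟨⟨ha, ha, by ring⟩, rfl⟩
    rw [this]
    simp
  · rw [Finset.filter_eq_empty_iff.mpr]
    · simp
    · rintro ⟨x, y⟩ hp hxy
      rw [mem_squarePairs hd hd] at hp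
      simp only at hp hxy
      subst hxy
      exact h ⟨x, hp.1, by rw [← hp.2.2]; ring⟩

theorem exists_thetaTail_sq {d : ℕ} (hd : 0 < d) :
    ∃ y : PowerSeries ℤ, thetaTail d ^ 2 = thetaTail (2 * d) + 2 * y := by
  have h : ∀ n, (2 : ℤ) ∣ coeff n (thetaTail d ^ 2) - coeff n (thetaTail (2 * d)) := by
    intro n
    rw [← Nat.cast_two, ← ZMod.intCast_zmod_eq_zero_iff_dvd _ 2]
    rw [Int.cast_sub, sq, cast_coeff_thetaTail_mul hd hd, card_squarePairs_self hd, sub_self]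
  choose y hy using h
  refine ⟨PowerSeries.mk y, ?_⟩
  ext n
  have h2 : (2 : PowerSeries ℤ) = C 2 := by simp
  rw [map_add, h2, coeff_C_mul, coeff_mk]
  linarith [hy n]

/-- The generating function of `schurOverpartitionCount 3` modulo `8`. -/
theorem exists_genFun_eq : ∃ H : PowerSeries ℤ,
    (PowerSeries.mk fun n => (schurOverpartitionCount 3 n : ℤ)) =
      1 + 2 * (thetaTail 2 + thetaTail 3 - thetaTail 1 - thetaTail 6) +
      4 * (thetaTail 2 + thetaTail 12 + thetaTail 2 * thetaTail 3 + thetaTail 1 * thetaTail 2 +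
        thetaTail 2 * thetaTail 6 + thetaTail 1 * thetaTail 3 + thetaTail 3 * thetaTail 6 +
        thetaTail 1 * thetaTail 6) + 8 * H := by
  have hG := genFun_mul_theta
  obtain ⟨y, hy⟩ := exists_thetaTail_sq (d := 1) one_pos
  obtain ⟨z, hz⟩ := exists_thetaTail_sq (d := 6) (by norm_num)
  norm_num at hy hz
  generalize (PowerSeries.mk fun n => (schurOverpartitionCount 3 n : ℤ)) = G at *
  generalize thetaTail 1 = a at *
  generalize thetaTail 2 = b at *
  generalize thetaTail 3 = c at *
  generalize thetaTail 6 = e at *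
  generalize thetaTail 12 = f at *
  -- Truncated geometric series for the inverse of `1 + 2a`, with `a²` replaced by `b + 2y`.
  have ha : (1 + 2 * a) * (1 - 2 * a + 4 * b) = 1 + 8 * (a ^ 3 - y * (1 + 2 * a)) := by
    linear_combination (-4 * (1 + 2 * a)) * hy
  have he : (1 + 2 * e) * (1 - 2 * e + 4 * f) = 1 + 8 * (e ^ 3 - z * (1 + 2 * e)) := by
    linear_combination (-4 * (1 + 2 * e)) * hz
  generalize a ^ 3 - y * (1 + 2 * a) = α at ha
  generalize e ^ 3 - z * (1 + 2 * e) = γ at he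
  -- The witness collects the higher terms of the expanded product, the sign changes in the
  -- quadratic part, and the inversion errors `α`, `γ`.
  refine ⟨-a * f - e * b + 2 * b * f + (b + c) * (b + f + a * e - 2 * a * f - 2 * e * b + 4 * b * f) +
    b * c * (-(a + e) + 2 * (b + f + a * e) - 4 * a * f - 4 * e * b + 8 * b * f) -
    b * a - c * a - b * e - c * e - G * (α + γ + 8 * α * γ), ?_⟩
  linear_combination (1 - 2 * a + 4 * b) * (1 - 2 * e + 4 * f) * hG -
    G * ((1 + 2 * e) * (1 - 2 * e + 4 * f)) * ha - G * (1 + 8 * α) * he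

end Coefficients

/-! ### Congruences modulo 4; quadratic forms at `4n`. -/

section Arithmetic

open PowerSeries

/-- The linear part of `schurOverpartitionCount 3 n` modulo `8`. -/
noncomputable def linearPart (n : ℕ) : ℤ :=
  coeff n (thetaTail 2) + coeff n (thetaTail 3) - coeff n (thetaTail 1) - coeff n (thetaTail 6)

/-- The quadratic part of `schurOverpartitionCount 3 n` modulo `8`. -/
noncomputable def quadraticPart (n : ℕ) : ZMod 2 :=
  ((coeff n (thetaTail 2) : ℤ) : ZMod 2) + ((coeff n (thetaTail 12) : ℤ) : ZMod 2) +
    (squarePairs 2 3 n).card + (squarePairs 1 2 n).card + (squarePairs 2 6 n).card +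
    (squarePairs 1 3 n).card + (squarePairs 3 6 n).card + (squarePairs 1 6 n).card

theorem exists_schurOverpartitionCount_eq {n : ℕ} (hn : 0 < n) :
    ∃ q h : ℤ, (schurOverpartitionCount 3 n : ℤ) = 2 * linearPart n + 4 * q + 8 * h ∧
      (q : ZMod 2) = quadraticPart n := by
  obtain ⟨H, hH⟩ := exists_genFun_eq
  have h2 : (2 : PowerSeries ℤ) = C 2 := by simp
  have h4 : (4 : PowerSeries ℤ) = C 4 := by simp
  have h8 : (8 : PowerSeries ℤ) = C 8 := by simp
  have h := congrArg (coeff n) hH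
  rw [coeff_mk, h2, h4, h8, map_add, map_add, map_add, coeff_C_mul, coeff_C_mul, coeff_C_mul,
    coeff_one, if_neg hn.ne', zero_add, map_sub, map_sub, map_add] at h
  refine ⟨_, _, h, ?_⟩
  simp only [map_add, Int.cast_add]
  rw [cast_coeff_thetaTail_mul, cast_coeff_thetaTail_mul, cast_coeff_thetaTail_mul,
    cast_coeff_thetaTail_mul, cast_coeff_thetaTail_mul, cast_coeff_thetaTail_mul, quadraticPart]
  all_goals norm_num

theorem cast_coeff_thetaTail_mul_mul {p k n : ℕ} (hp : 0 < p) (hk : 0 < k) :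
    ((coeff (p * n) (thetaTail (p * k)) : ℤ) : ZMod 2) =
      ((coeff n (thetaTail k) : ℤ) : ZMod 2) := by
  classical
  rw [cast_coeff_thetaTail hk, cast_coeff_thetaTail (Nat.mul_pos hp hk)]
  refine if_congr (exists_congr fun a => and_congr_right fun _ => ?_) rfl rfl
  rw [mul_assoc]
  exact Nat.mul_right_inj hp.ne'

/-- If `k a² = p n` then `p ∣ a`, say `a = p b`, and `n = p k b²`. -/
theorem cast_coeff_thetaTail_prime_mul {p k n : ℕ} (hp : p.Prime) (hk : 0 < k) (hpk : ¬ p ∣ k) :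
    ((coeff (p * n) (thetaTail k) : ℤ) : ZMod 2) =
      ((coeff n (thetaTail (p * k)) : ℤ) : ZMod 2) := by
  classical
  rw [cast_coeff_thetaTail hk, cast_coeff_thetaTail (Nat.mul_pos hp.pos hk)]
  refine if_congr ⟨?_, ?_⟩ rfl rfl
  · rintro ⟨a, ha, h⟩
    obtain ⟨b, rfl⟩ : p ∣ a := hp.dvd_of_dvd_pow
      (((hp.dvd_mul).mp (Dvd.intro n h.symm)).resolve_left hpk)
    refine ⟨b, Nat.pos_of_ne_zero fun hb => by simp [hb] at ha, ?_⟩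
    apply Nat.eq_of_mul_eq_mul_left hp.pos
    rw [← h]
    ring
  · rintro ⟨a, ha, rfl⟩
    exact ⟨p * a, Nat.mul_pos hp.pos ha, by ring⟩

theorem cast_linearPart (n : ℕ) : (linearPart n : ZMod 2) =
    ((coeff n (thetaTail 2) : ℤ) : ZMod 2) + ((coeff n (thetaTail 3) : ℤ) : ZMod 2) +
      ((coeff n (thetaTail 1) : ℤ) : ZMod 2) + ((coeff n (thetaTail 6) : ℤ) : ZMod 2) := by
  have h : ∀ x : ZMod 2, -x = x := by decide
  rw [linearPart]
  push_cast
  rw [sub_eq_add_neg, sub_eq_add_neg, h, h]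

/-- Doubling exchanges the classes 1 and 2, and 3 and 6, up to squares. -/
theorem cast_linearPart_two_mul (n : ℕ) : (linearPart (2 * n) : ZMod 2) = linearPart n := by
  have h1 := cast_coeff_thetaTail_prime_mul (k := 1) (n := n) Nat.prime_two (by simp) (by simp)
  have h3 := cast_coeff_thetaTail_prime_mul (k := 3) (n := n) Nat.prime_two (by simp) (by simp)
  have h2 := cast_coeff_thetaTail_mul_mul (p := 2) (k := 1) (n := n) two_pos one_pos
  have h6 := cast_coeff_thetaTail_mul_mul (p := 2) (k := 3) (n := n) two_pos three_pos
  rw [cast_linearPart, cast_linearPart]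
  linear_combination h1 + h2 + h3 + h6

theorem cast_linearPart_three_mul (n : ℕ) : (linearPart (3 * n) : ZMod 2) = linearPart n := by
  have h1 := cast_coeff_thetaTail_prime_mul (k := 1) (n := n) Nat.prime_three (by simp) (by simp)
  have h2 := cast_coeff_thetaTail_prime_mul (k := 2) (n := n) Nat.prime_three (by simp) (by simp)
  have h3 := cast_coeff_thetaTail_mul_mul (p := 3) (k := 1) (n := n) three_pos one_pos
  have h6 := cast_coeff_thetaTail_mul_mul (p := 3) (k := 2) (n := n) three_pos two_pos
  rw [cast_linearPart, cast_linearPart]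
  linear_combination h1 + h2 + h3 + h6

theorem count_modEq_four {m n : ℕ} (hm : 0 < m) (hn : 0 < n)
    (h : (linearPart m : ZMod 2) = linearPart n) :
    schurOverpartitionCount 3 m ≡ schurOverpartitionCount 3 n [MOD 4] := by
  obtain ⟨q, k, h1, -⟩ := exists_schurOverpartitionCount_eq hm
  obtain ⟨q', k', h2, -⟩ := exists_schurOverpartitionCount_eq hn
  have h3 := (ZMod.intCast_eq_intCast_iff _ _ 2).mp h
  rw [Int.ModEq] at h3
  push_cast at h3
  rw [← Int.natCast_modEq_iff, Int.ModEq]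
  push_cast
  omega

theorem count_three_mul (n : ℕ) :
    schurOverpartitionCount 3 (3 * n) ≡ schurOverpartitionCount 3 n [MOD 4] := by
  rcases n.eq_zero_or_pos with rfl | hn
  · rfl
  · exact count_modEq_four (by omega) hn (cast_linearPart_three_mul n)

theorem count_two_mul (n : ℕ) :
    schurOverpartitionCount 3 (2 * n) ≡ schurOverpartitionCount 3 n [MOD 4] := by
  rcases n.eq_zero_or_pos with rfl | hn
  · rfl
  · exact count_modEq_four (by omega) hn (cast_linearPart_two_mul n)

theorem count_two_pow_mul (α n : ℕ) :
    schurOverpartitionCount 3 (2 ^ α * n) ≡ schurOverpartitionCount 3 n [MOD 4] := by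
  induction α with
  | zero => simp [Nat.ModEq]
  | succ α ih =>
    rw [pow_succ', mul_assoc]
    exact (count_two_mul _).trans ih

/-- A jump of `2δ` in the linear part contributes `4δ`, which the quadratic part can absorb. -/
theorem count_modEq_eight {m n : ℕ} (hm : 0 < m) (hn : 0 < n) {δ : ℤ}
    (h : linearPart m = linearPart n + 2 * δ) (h' : (δ : ZMod 2) + quadraticPart m = quadraticPart n) :
    schurOverpartitionCount 3 m ≡ schurOverpartitionCount 3 n [MOD 8] := by
  obtain ⟨q, k, h1, hq⟩ := exists_schurOverpartitionCount_eq hm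
  obtain ⟨q', k', h2, hq'⟩ := exists_schurOverpartitionCount_eq hn
  rw [← hq, ← hq', ← Int.cast_add] at h'
  have h3 := (ZMod.intCast_eq_intCast_iff _ _ 2).mp h'
  rw [Int.ModEq] at h3
  push_cast at h3
  rw [← Int.natCast_modEq_iff, Int.ModEq]
  push_cast
  omega

theorem sq_mod_four (a : ℕ) : (a % 2 = 0 ∧ a ^ 2 % 4 = 0) ∨ (a % 2 = 1 ∧ a ^ 2 % 8 = 1) := by
  have h : a ^ 2 % 8 = (a % 8) ^ 2 % 8 := Nat.pow_mod a 2 8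
  have h8 : a % 8 < 8 := Nat.mod_lt _ (by norm_num)
  have : a % 8 % 2 = a % 2 := by omega
  rw [← this]
  have h4 : a ^ 2 % 4 = a ^ 2 % 8 % 4 := by omega
  rw [h4, h]
  generalize a % 8 = r at *
  revert h8
  clear h4 h this
  revert r
  decide

theorem card_filter_even_squarePairs {i j : ℕ} (hi : 0 < i) (hj : 0 < j) (n : ℕ) :
    ((squarePairs i j (4 * n)).filter fun p => p.1 % 2 = 0 ∧ p.2 % 2 = 0).card =
      (squarePairs i j n).card := by
  refine Finset.card_nbij' (fun p => (p.1 / 2, p.2 / 2)) (fun p => (2 * p.1, 2 * p.2)) ?_ ?_ ?_ ?_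
  · rintro ⟨a, b⟩ h
    simp only [Finset.mem_coe, Finset.mem_filter, mem_squarePairs hi hj] at h ⊢
    obtain ⟨c, rfl⟩ := Nat.dvd_of_mod_eq_zero h.2.1
    obtain ⟨d, rfl⟩ := Nat.dvd_of_mod_eq_zero h.2.2
    simp only [Nat.mul_div_cancel_left _ two_pos]
    exact ⟨by omega, by omega, by linarith [h.1.2.2]⟩
  · rintro ⟨a, b⟩ h
    simp only [Finset.mem_coe, Finset.mem_filter, mem_squarePairs hi hj] at h ⊢
    exact ⟨⟨by omega, by omega, by linarith [h.2.2]⟩, by omega, by omega⟩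
  · rintro ⟨a, b⟩ h
    simp only [Finset.mem_coe, Finset.mem_filter] at h
    ext <;> simp <;> omega
  · rintro ⟨a, b⟩ h
    simp

/-- For these residues `i a² + j b²` vanishes mod 4 only if both `a` and `b` are even. -/
theorem card_squarePairs_four_mul {i j : ℕ} (hi : 0 < i) (hj : 0 < j) (n : ℕ)
    (h : (i % 4, j % 4) ∈ ({(1, 2), (2, 3), (3, 2)} : Finset (ℕ × ℕ))) :
    (squarePairs i j (4 * n)).card = (squarePairs i j n).card := by
  rw [← card_filter_even_squarePairs hi hj n, Finset.filter_true_of_mem]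
  rintro ⟨a, b⟩ hp
  rw [mem_squarePairs hi hj] at hp
  have h4 : ((i % 4) * (a ^ 2 % 4) + (j % 4) * (b ^ 2 % 4)) % 4 = 0 := by
    rw [← Nat.mul_mod_right 4 n, ← hp.2.2]
    simp [Nat.add_mod, Nat.mul_mod]
  simp only [Finset.mem_insert, Finset.mem_singleton, Prod.mk.injEq] at h
  rcases sq_mod_four a with ⟨ha, ha'⟩ | ⟨ha, ha'⟩ <;>
    rcases sq_mod_four b with ⟨hb, hb'⟩ | ⟨hb, hb'⟩ <;>
    rcases h with ⟨hi', hj'⟩ | ⟨hi', hj'⟩ | ⟨hi', hj'⟩ <;>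
    rw [hi', hj'] at h4 <;> simp only <;> omega

/-- The solutions of `a^2 + 3 b^2 = n` in odd positive integers. -/
def oddPairs (n : ℕ) : Finset (ℕ × ℕ) :=
  (squarePairs 1 3 n).filter fun p => p.1 % 2 = 1 ∧ p.2 % 2 = 1

theorem mem_oddPairs {n a b : ℕ} :
    (a, b) ∈ oddPairs n ↔ a % 2 = 1 ∧ b % 2 = 1 ∧ a ^ 2 + 3 * b ^ 2 = n := by
  rw [oddPairs, Finset.mem_filter, mem_squarePairs one_pos three_pos]
  simp only [one_mul]
  constructor
  · rintro ⟨⟨_, _, h⟩, h1, h2⟩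
    exact ⟨h1, h2, h⟩
  · rintro ⟨h1, h2, h⟩
    exact ⟨⟨by omega, by omega, h⟩, h1, h2⟩

theorem card_squarePairs_one_three (n : ℕ) :
    (squarePairs 1 3 (4 * n)).card = (squarePairs 1 3 n).card + (oddPairs (4 * n)).card := by
  rw [← card_filter_even_squarePairs one_pos three_pos n, oddPairs,
    ← Finset.card_filter_add_card_filter_not (s := squarePairs 1 3 (4 * n))
      (fun p => p.1 % 2 = 0 ∧ p.2 % 2 = 0)]
  congr 2
  refine Finset.filter_congr ?_
  rintro ⟨a, b⟩ hp
  rw [mem_squarePairs one_pos three_pos] at hp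
  have h := hp.2.2
  simp only at h ⊢
  rcases sq_mod_four a with ⟨ha, ha'⟩ | ⟨ha, ha'⟩ <;>
    rcases sq_mod_four b with ⟨hb, hb'⟩ | ⟨hb, hb'⟩ <;> omega

/-- For odd `a`, `b`, `a² + 3b² ≡ 4` mod 8. -/
theorem oddPairs_eq_empty {n : ℕ} (hn : n % 2 = 0) : oddPairs (4 * n) = ∅ := by
  refine Finset.eq_empty_of_forall_notMem ?_
  rintro ⟨a, b⟩ hp
  obtain ⟨ha, hb, h⟩ := mem_oddPairs.mp hp
  have := sq_mod_four a
  have := sq_mod_four b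
  omega

/-- Multiplication of `a + b √-3` by a sixth root of unity, up to signs, chosen so as to preserve
the oddness of both coordinates. -/
def rotatePair (p : ℕ × ℕ) : ℕ × ℕ :=
  if p.1 % 4 = p.2 % 4 then (((p.1 : ℤ) - 3 * p.2).natAbs / 2, (p.1 + p.2) / 2)
  else ((p.1 + 3 * p.2) / 2, ((p.1 : ℤ) - p.2).natAbs / 2)

/-- Both `(a - 3b)² + 3(a + b)²` and `(a + 3b)² + 3(a - b)²` equal `4(a² + 3b²)`; whether `a ≡ b`
mod 4 decides which choice has odd halves. -/
theorem rotatePair_mem {n : ℕ} {p : ℕ × ℕ} (hp : p ∈ oddPairs n) : rotatePair p ∈ oddPairs n := by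
  obtain ⟨a, b⟩ := p
  obtain ⟨ha, hb, h⟩ := mem_oddPairs.mp hp
  unfold rotatePair
  simp only
  split_ifs with hab
  · rw [mem_oddPairs]
    refine ⟨by omega, by omega, ?_⟩
    obtain ⟨c, hc⟩ : ∃ c, ((a : ℤ) - 3 * b).natAbs = 2 * c := ⟨((a : ℤ) - 3 * b).natAbs / 2, by omega⟩
    obtain ⟨d, hd⟩ : ∃ d, a + b = 2 * d := ⟨(a + b) / 2, by omega⟩
    rw [hc, hd, Nat.mul_div_cancel_left _ two_pos, Nat.mul_div_cancel_left _ two_pos]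
    have h1 : (2 * (c : ℤ)) ^ 2 = ((a : ℤ) - 3 * b) ^ 2 := by
      rw [← Int.natAbs_sq (a - 3 * b), hc]
      push_cast
      ring
    zify at h hd ⊢
    have h2 : 4 * ((c : ℤ) ^ 2 + 3 * d ^ 2) = 4 * n := by
      linear_combination 4 * h + h1 - 3 * (a + b + 2 * d) * hd
    linarith
  · rw [mem_oddPairs]
    refine ⟨by omega, by omega, ?_⟩
    obtain ⟨c, hc⟩ : ∃ c, ((a : ℤ) - b).natAbs = 2 * c := ⟨((a : ℤ) - b).natAbs / 2, by omega⟩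
    obtain ⟨d, hd⟩ : ∃ d, a + 3 * b = 2 * d := ⟨(a + 3 * b) / 2, by omega⟩
    rw [hc, hd, Nat.mul_div_cancel_left _ two_pos, Nat.mul_div_cancel_left _ two_pos]
    have h1 : (2 * (c : ℤ)) ^ 2 = ((a : ℤ) - b) ^ 2 := by
      rw [← Int.natAbs_sq (a - b), hc]
      push_cast
      ring
    zify at h hd ⊢
    have h2 : 4 * ((d : ℤ) ^ 2 + 3 * c ^ 2) = 4 * n := by
      linear_combination 4 * h + 3 * h1 - (a + 3 * b + 2 * d) * hd
    linarith

theorem rotatePair_rotatePair {n : ℕ} {p : ℕ × ℕ} (hp : p ∈ oddPairs n) :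
    rotatePair (rotatePair p) = p := by
  obtain ⟨a, b⟩ := p
  obtain ⟨ha, hb, h⟩ := mem_oddPairs.mp hp
  unfold rotatePair
  simp only
  split_ifs <;> ext <;> simp only at * <;> omega

end Arithmetic

/-! ### Congruences modulo 8. -/

section ModEight

open PowerSeries

theorem sq_mod_three (a : ℕ) : (a % 3 = 0 ∧ a ^ 2 % 3 = 0) ∨
    (a % 3 ≠ 0 ∧ a ^ 2 % 3 = 1) := by
  rw [Nat.pow_mod]
  have : a % 3 < 3 := Nat.mod_lt _ (by norm_num)
  interval_cases a % 3 <;> simp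

/-- The only other fixed points have `a = 3b`, so `n = 12b²`, which `3 ∤ n` excludes. -/
theorem rotatePair_eq_self_iff {n : ℕ} (hn : n % 3 ≠ 0) {p : ℕ × ℕ} (hp : p ∈ oddPairs n) :
    rotatePair p = p ↔ p.1 = p.2 := by
  obtain ⟨a, b⟩ := p
  obtain ⟨ha, hb, h⟩ := mem_oddPairs.mp hp
  have h3 := sq_mod_three a
  unfold rotatePair
  simp only
  split_ifs <;> simp only [Prod.mk.injEq] <;> omega

open Classical in
theorem card_oddPairs {n : ℕ} (hn : n % 3 ≠ 0) : ((oddPairs (4 * n)).card : ZMod 2) =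
    if ∃ a, a % 2 = 1 ∧ a ^ 2 = n then 1 else 0 := by
  rw [← Finset.card_filter_add_card_filter_not (s := oddPairs (4 * n)) (fun p => p.1 = p.2)]
  have hn' : 4 * n % 3 ≠ 0 := by omega
  have h0 : (((oddPairs (4 * n)).filter fun p => ¬ p.1 = p.2).card : ZMod 2) = 0 := by
    rw [Finset.card_eq_sum_ones]
    push_cast
    refine Finset.sum_involution (fun p _ => rotatePair p) (fun _ _ => by decide) ?_ ?_ ?_
    · intro p hp _ h
      rw [Finset.mem_filter] at hp
      exact hp.2 ((rotatePair_eq_self_iff hn' hp.1).mp h)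
    · intro p hp
      rw [Finset.mem_filter] at hp ⊢
      refine ⟨rotatePair_mem hp.1, fun h => hp.2 ?_⟩
      rw [← rotatePair_eq_self_iff hn' (rotatePair_mem hp.1), rotatePair_rotatePair hp.1] at h
      exact (rotatePair_eq_self_iff hn' hp.1).mp h.symm
    · intro p hp
      exact rotatePair_rotatePair (Finset.mem_filter.mp hp).1
  rw [Nat.cast_add, h0, add_zero]
  split_ifs with h
  · obtain ⟨a, ha, rfl⟩ := h
    have : (oddPairs (4 * a ^ 2)).filter (fun p => p.1 = p.2) = {(a, a)} := by
      ext ⟨x, y⟩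
      rw [Finset.mem_filter, mem_oddPairs, Finset.mem_singleton, Prod.mk.injEq]
      constructor
      · rintro ⟨⟨_, _, h⟩, hxy⟩
        simp only at hxy
        subst hxy
        have := Nat.pow_left_injective two_ne_zero (show x ^ 2 = a ^ 2 by omega)
        exact ⟨this, this⟩
      · rintro ⟨rfl, rfl⟩
        exact ⟨⟨ha, ha, by ring⟩, rfl⟩
    rw [this]
    simp
  · rw [Finset.filter_eq_empty_iff.mpr]
    · simp
    · rintro ⟨x, y⟩ hp hxy
      obtain ⟨hx, hy, h'⟩ := mem_oddPairs.mp hp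
      simp only at hxy
      subst hxy
      exact h ⟨x, hx, by omega⟩

theorem squarePairs_two_six_of_odd {n : ℕ} (hn : n % 2 = 1) : squarePairs 2 6 n = ∅ := by
  refine Finset.eq_empty_of_forall_notMem fun p hp => ?_
  rw [mem_squarePairs (by norm_num) (by norm_num)] at hp
  omega

theorem squarePairs_two_six (n : ℕ) : squarePairs 2 6 (2 * n) = squarePairs 1 3 n := by
  ext p
  rw [mem_squarePairs (by norm_num) (by norm_num), mem_squarePairs (by norm_num) (by norm_num)]
  omega

theorem squarePairs_one_three_of_odd (n : ℕ) (hn : n % 2 = 1) : squarePairs 1 3 (2 * n) = ∅ := by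
  refine Finset.eq_empty_of_forall_notMem fun p hp => ?_
  rw [mem_squarePairs (by norm_num) (by norm_num)] at hp
  have := sq_mod_four p.1
  have := sq_mod_four p.2
  omega

theorem squarePairs_one_three_of_mod_three {n : ℕ} (hn : n % 3 = 2) : squarePairs 1 3 n = ∅ := by
  refine Finset.eq_empty_of_forall_notMem fun p hp => ?_
  rw [mem_squarePairs (by norm_num) (by norm_num)] at hp
  have := sq_mod_three p.1
  omega

theorem squarePairs_two_six_of_mod_three {n : ℕ} (hn : n % 3 = 1) : squarePairs 2 6 n = ∅ := by
  refine Finset.eq_empty_of_forall_notMem fun p hp => ?_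
  rw [mem_squarePairs (by norm_num) (by norm_num)] at hp
  have := sq_mod_three p.1
  omega

theorem coeff_thetaTail_of_mod_three {d n : ℕ} (h0 : n % 3 ≠ 0) (hd : n % 3 ≠ d % 3) :
    coeff n (thetaTail d) = 0 := by
  refine coeff_thetaTail_eq_zero fun a _ h => ?_
  have h' : (d % 3) * (a ^ 2 % 3) % 3 = n % 3 := by rw [← Nat.mul_mod, h]
  rcases sq_mod_three a with ⟨-, h1⟩ | ⟨-, h1⟩ <;> rw [h1] at h' <;> omega

/-- `quadraticPart n` already contains the (2,6) count at `n`; adding it again removes it mod 2, in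
favour of the count at `4n`. -/
theorem quadraticPart_four_mul {n : ℕ} (hn : n % 3 ≠ 0) :
    quadraticPart (4 * n) = quadraticPart n + (squarePairs 2 6 (4 * n)).card +
      (squarePairs 2 6 n).card + (oddPairs (4 * n)).card := by
  have h2 : ((coeff (4 * n) (thetaTail 2) : ℤ) : ZMod 2) =
      ((coeff n (thetaTail 2) : ℤ) : ZMod 2) := by
    rw [show 4 * n = 2 * (2 * n) by ring,
      cast_coeff_thetaTail_mul_mul (p := 2) (k := 1) two_pos one_pos,
      cast_coeff_thetaTail_prime_mul (k := 1) Nat.prime_two (by simp) (by simp)]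
  have h : ∀ x : ZMod 2, x + x = 0 := by decide
  rw [quadraticPart, quadraticPart, h2,
    coeff_thetaTail_of_mod_three (d := 12) (n := 4 * n) (by omega) (by omega),
    coeff_thetaTail_of_mod_three (d := 12) hn (by omega),
    card_squarePairs_four_mul (i := 2) (j := 3) (by simp) (by simp) n (by simp),
    card_squarePairs_four_mul (i := 1) (j := 2) (by simp) (by simp) n (by simp),
    card_squarePairs_four_mul (i := 3) (j := 6) (by simp) (by simp) n (by simp),
    card_squarePairs_four_mul (i := 1) (j := 6) (by simp) (by simp) n (by simp),
    card_squarePairs_one_three]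
  push_cast
  linear_combination -h ((squarePairs 2 6 n).card : ZMod 2)

theorem coeff_four_mul_thetaTail_two {n a : ℕ} (ha : 1 ≤ a) (h : 2 * a ^ 2 = n) :
    coeff (4 * n) (thetaTail 2) = 1 := by
  have : 4 * n = 2 * (2 * a) ^ 2 := by rw [← h]; ring
  rw [this, coeff_thetaTail_mul_sq two_pos (by omega)]
  simp

theorem coeff_four_mul_thetaTail_two_eq_zero {n : ℕ} (h : ∀ a, 1 ≤ a → 2 * a ^ 2 ≠ n) :
    coeff (4 * n) (thetaTail 2) = 0 := by
  refine coeff_thetaTail_eq_zero fun a ha h' => ?_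
  obtain ⟨b, rfl⟩ : 2 ∣ a := by
    have := sq_mod_four a
    omega
  exact h b (by omega) (by linarith)

theorem coeff_four_mul_thetaTail_one {n : ℕ} (hn : n % 2 = 0) :
    coeff (4 * n) (thetaTail 1) = coeff n (thetaTail 1) := by
  by_cases h : ∃ a, 1 ≤ a ∧ 1 * a ^ 2 = n
  · obtain ⟨a, ha, rfl⟩ := h
    have he : Even a := by
      have := sq_mod_four a
      rw [Nat.even_iff]
      omega
    have h4 : 4 * (1 * a ^ 2) = 1 * (2 * a) ^ 2 := by ring
    rw [h4, coeff_thetaTail_mul_sq one_pos (by omega), coeff_thetaTail_mul_sq one_pos ha,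
      he.neg_one_pow]
    simp
  · rw [coeff_thetaTail_eq_zero fun a ha h' => h ⟨a, ha, h'⟩]
    refine coeff_thetaTail_eq_zero fun a ha h' => ?_
    obtain ⟨b, rfl⟩ : 2 ∣ a := by
      have := sq_mod_four a
      omega
    exact h ⟨b, by omega, by linarith⟩

theorem count_four_mul_of_mod_three_eq_one {n : ℕ} (h3 : n % 3 = 1) (h2 : n % 2 = 0) :
    schurOverpartitionCount 3 (4 * n) ≡ schurOverpartitionCount 3 n [MOD 8] := by
  refine count_modEq_eight (δ := 0) (by omega) (by omega) ?_ ?_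
  · rw [linearPart, linearPart, coeff_four_mul_thetaTail_one h2]
    have e : ∀ m d, m % 3 = 1 → d % 3 ≠ 1 → coeff m (thetaTail d) = 0 := fun m d hm hd =>
      coeff_thetaTail_of_mod_three (by omega) (by omega)
    have h4 : 4 * n % 3 = 1 := by omega
    simp [e, h3, h4]
  · rw [quadraticPart_four_mul (by omega), oddPairs_eq_empty h2,
      squarePairs_two_six_of_mod_three h3, squarePairs_two_six_of_mod_three (by omega)]
    simp

open Classical in
-- For `n = 2m`, halving the form reduces the excess to odd solutions of `a² + 3b² = 4m`, counted
-- mod 2 by `card_oddPairs`.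
theorem card_squarePairs_two_six_four_mul {n : ℕ} (h3 : n % 3 = 2) :
    ((squarePairs 2 6 (4 * n)).card : ZMod 2) = (squarePairs 2 6 n).card +
      if ∃ a, a % 2 = 1 ∧ 2 * a ^ 2 = n then 1 else 0 := by
  have h4 : 4 * n = 2 * (2 * n) := by ring
  rw [h4, squarePairs_two_six]
  rcases Nat.mod_two_eq_zero_or_one n with h | h
  · obtain ⟨m, rfl⟩ := Nat.dvd_of_mod_eq_zero h
    rw [squarePairs_two_six, show 2 * (2 * m) = 4 * m by ring, card_squarePairs_one_three,
      Nat.cast_add, card_oddPairs (by omega)]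
    congr 1
    refine if_congr (exists_congr fun a => and_congr_right fun _ => ?_) rfl rfl
    omega
  · rw [squarePairs_one_three_of_odd n h, squarePairs_two_six_of_odd h, if_neg]
    · simp
    · rintro ⟨a, -, rfl⟩
      omega

theorem count_four_mul_of_mod_three_eq_two {n : ℕ} (h3 : n % 3 = 2) :
    schurOverpartitionCount 3 (4 * n) ≡ schurOverpartitionCount 3 n [MOD 8] := by
  classical
  have h : ∀ x : ZMod 2, x + x = 0 := by decide
  -- At `n = 2a²` with `a` odd, the coefficient of `T_2` goes from -1 to 1, since `4n = 2(2a)²`; the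
  -- (2,6) count changes parity there too.
  refine count_modEq_eight (δ := if ∃ a, a % 2 = 1 ∧ 2 * a ^ 2 = n then 1 else 0)
    (by omega) (by omega) ?_ ?_
  · have e : ∀ m, m % 3 = 2 → linearPart m = coeff m (thetaTail 2) := by
      intro m hm
      rw [linearPart]
      have e : ∀ d, d % 3 ≠ 2 → coeff m (thetaTail d) = 0 := fun d hd =>
        coeff_thetaTail_of_mod_three (by omega) (by omega)
      simp [e]
    rw [e n h3, e (4 * n) (by omega)]
    by_cases hs : ∃ a, 1 ≤ a ∧ 2 * a ^ 2 = n
    · obtain ⟨a, ha, hs⟩ := hs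
      rw [coeff_four_mul_thetaTail_two ha hs]
      have hc : coeff n (thetaTail 2) = (-1) ^ a := by
        rw [← hs, coeff_thetaTail_mul_sq two_pos ha]
      rw [hc]
      rcases Nat.mod_two_eq_zero_or_one a with hp | hp
      · rw [if_neg, (Nat.even_iff.mpr hp).neg_one_pow]
        · simp
        · rintro ⟨b, hb, hb'⟩
          have := Nat.pow_left_injective two_ne_zero (show b ^ 2 = a ^ 2 by omega)
          omega
      · rw [if_pos ⟨a, hp, hs⟩, (Nat.odd_iff.mpr hp).neg_one_pow]
        norm_num
    · rw [coeff_four_mul_thetaTail_two_eq_zero fun a ha h' => hs ⟨a, ha, h'⟩,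
        coeff_thetaTail_eq_zero fun a ha h' => hs ⟨a, ha, h'⟩, if_neg]
      · simp
      · rintro ⟨a, ha, h'⟩
        exact hs ⟨a, by omega, h'⟩
  · have ho : (oddPairs (4 * n)).card = 0 := by
      rw [oddPairs, squarePairs_one_three_of_mod_three (by omega)]
      simp
    rw [quadraticPart_four_mul (by omega), card_squarePairs_two_six_four_mul h3, ho]
    push_cast
    linear_combination h (if ∃ a, a % 2 = 1 ∧ 2 * a ^ 2 = n then (1 : ZMod 2) else 0) +
      h ((squarePairs 2 6 n).card : ZMod 2)

theorem count_four_pow_mul {n : ℕ} (h : n % 3 = 2 ∨ n % 3 = 1 ∧ n % 2 = 0) (β : ℕ) :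
    schurOverpartitionCount 3 (4 ^ β * n) ≡ schurOverpartitionCount 3 n [MOD 8] := by
  induction β with
  | zero => simp [Nat.ModEq]
  | succ β ih =>
    refine Nat.ModEq.trans ?_ ih
    rw [pow_succ', mul_assoc]
    have h4 : 4 ^ β % 3 = 1 := by rw [Nat.pow_mod]; simp
    have hm : 4 ^ β * n % 3 = n % 3 := by rw [Nat.mul_mod, h4, one_mul, Nat.mod_mod]
    rcases h with h | ⟨h, h'⟩
    · exact count_four_mul_of_mod_three_eq_two (hm.trans h)
    · exact count_four_mul_of_mod_three_eq_one (hm.trans h) (by rw [Nat.mul_mod, h']; simp)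

end ModEight

theorem theorem4p2 :
    (∀ n : ℕ,
      schurOverpartitionCount 3 (3 * n) ≡ schurOverpartitionCount 3 n [MOD 4]) ∧
    (∀ n α j : ℕ, j ∈ ({0, 1, 2} : Finset ℕ) →
      schurOverpartitionCount 3 (2 ^ α * (3 * n + j)) ≡
        schurOverpartitionCount 3 (3 * n + j) [MOD 4]) ∧
    (∀ n β j : ℕ, 1 ≤ β → j ∈ ({0, 1} : Finset ℕ) →
      schurOverpartitionCount 3 (2 ^ (2 * β + j) * (3 * n + 2)) ≡
        schurOverpartitionCount 3 (2 ^ j * (3 * n + 2)) [MOD 8]) := by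
  refine ⟨count_three_mul, fun n α j _ => count_two_pow_mul α _, fun n β j _ hj => ?_⟩
  rw [pow_add, pow_mul, mul_assoc]
  -- `3n + 2` is 2 mod 3, and its double is even and 1 mod 3.
  refine count_four_pow_mul ?_ β
  simp only [Finset.mem_insert, Finset.mem_singleton] at hj
  rcases hj with rfl | rfl <;> omega
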